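/- All graphs are finite, simple and undirected. Call a graph $P_k$-free if it does not contain the path on $k$ vertices as an induced subgraph. A sequence $(b_1,\dots,b_m)$ of vertices of a graph $G$ is a burning sequence of $G$ of size $m$ if, in the process in which nothing is burned at time $0$ and at each time $t=1,\dots,m$ the fire spreads from every vertex burned by time $t-1$ to all its neighbours while $b_t$ is set on fire, each $b_t$ is unburned at the end of time $t-1$, and every vertex $v$ of $G$ is within distance $m-i$ of some $b_i$. There is an algorithm which, given the adjacency matrix of a connected graph $G$ on $n$ vertices, finds a burning sequence of $G$; for every integer $k\ge 2$ such that $G$ is $P_k$-free, this sequence has size at most $\lceil\frac{k+1}{2}\rceil$ and the running time is $O(kn^7)$. The constant in the $O$ is absolute (independent of $G$, $n$ and $k$), and running time is the number of steps on a word RAM whose words have $O(\log n)$ bits. -/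

import Mathlib

/-! ### Graph burning -/

namespace Burning

variable {V : Type*}

/-- `burned G B t` is the set of vertices burned at the end of time step `t`, when the fires are
started at the entries of `B`, one per time step. Nothing burns at time `0`; at time `t + 1` the
fire spreads from every burned vertex to its neighbours, and the next entry of `B`
(the list `B` is indexed from `0`) catches fire. -/
def burned (G : SimpleGraph V) (B : List V) : ℕ → Set V
  | 0 => ∅
  | t + 1 => {v | v ∈ burned G B t ∨ (∃ u ∈ burned G B t, G.Adj u v) ∨ B[t]? = some v}

/-- `B = (b₁, …, b_m)` is a burning sequence of `G`: each source `b_i` is unburned at the beginning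
of step `i` (so that it is a legal choice at time `i`), and every vertex is at distance at most
`m - i` from some source `b_i`. The list index is `i - 1`. -/
def IsBurningSequence (G : SimpleGraph V) (B : List V) : Prop :=
  (∀ i : Fin B.length, B.get i ∉ burned G B i) ∧
  ∀ v : V, ∃ i : Fin B.length, G.edist v (B.get i) ≤ ((B.length - ((i : ℕ) + 1) : ℕ) : ℕ∞)

/-- `G` contains no path on `k` vertices as an induced subgraph. -/
def IsPathFree (G : SimpleGraph V) (k : ℕ) : Prop :=
  ¬ (SimpleGraph.pathGraph k).IsIndContained G

end Burning

/-! ### A word RAM with unit cost per elementary instruction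

The machine has registers and a random access memory, both of which hold words of `w` bits,
i.e. natural numbers below `2 ^ w`. Programs are finite, do not depend on the input or on `w`, and
are written with sequencing, branching and loops instead of jumps. -/

namespace WordRAM

/-- Elementary instructions; the arguments are names of registers. -/
inductive Instr : Type
  /-- `const r a`: put the constant `a` in register `r`. -/
  | const (r a : ℕ)
  /-- `move r x`: copy register `x` to register `r`. -/
  | move (r x : ℕ)
  /-- `add r x y`: put the sum of registers `x` and `y` in register `r`. -/
  | add (r x y : ℕ)
  /-- `sub r x y`: put the (truncated) difference of registers `x` and `y` in register `r`. -/
  | sub (r x y : ℕ)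
  /-- `mul r x y`: put the product of registers `x` and `y` in register `r`. -/
  | mul (r x y : ℕ)
  /-- `load r x`: copy to register `r` the memory cell whose address is in register `x`. -/
  | load (r x : ℕ)
  /-- `store x r`: copy register `r` to the memory cell whose address is in register `x`. -/
  | store (x r : ℕ)

/-- Comparisons of two registers. -/
inductive Test : Type
  | lt (x y : ℕ)
  | eq (x y : ℕ)

/-- Programs. -/
inductive Prog : Type
  | skip
  | instr (i : Instr)
  | seq (p q : Prog)
  /-- If the test holds then run `p`, else run `q`. -/
  | branch (b : Test) (p q : Prog)
  /-- While the test holds, run `p`. -/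
  | loop (b : Test) (p : Prog)

/-- A state of the machine: contents of the registers and of the memory. -/
structure State : Type where
  reg : ℕ → ℕ
  mem : ℕ → ℕ

/-- Change the contents of register `r` to `a`. -/
def State.setReg (s : State) (r a : ℕ) : State := ⟨Function.update s.reg r a, s.mem⟩

/-- Change the contents of memory cell `x` to `a`. -/
def State.setMem (s : State) (x a : ℕ) : State := ⟨s.reg, Function.update s.mem x a⟩

/-- Effect of an elementary instruction on a machine with words of `w` bits;
arithmetic is modulo `2 ^ w`. -/
def Instr.exec (w : ℕ) : Instr → State → State
  | .const r a, s => s.setReg r (a % 2 ^ w)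
  | .move r x, s => s.setReg r (s.reg x)
  | .add r x y, s => s.setReg r ((s.reg x + s.reg y) % 2 ^ w)
  | .sub r x y, s => s.setReg r (s.reg x - s.reg y)
  | .mul r x y, s => s.setReg r ((s.reg x * s.reg y) % 2 ^ w)
  | .load r x, s => s.setReg r (s.mem (s.reg x))
  | .store x r, s => s.setMem (s.reg x) (s.reg r)

/-- The test holds in the state `s`. -/
def Test.Holds : Test → State → Prop
  | .lt x y, s => s.reg x < s.reg y
  | .eq x y, s => s.reg x = s.reg y

/-- `Exec w p s t s'`: started in the state `s` on a machine with words of `w` bits, the program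
`p` halts after exactly `t` steps in the state `s'`. Every elementary instruction and every
evaluation of a test is one step. -/
inductive Exec (w : ℕ) : Prog → State → ℕ → State → Prop
  | skip (s : State) : Exec w .skip s 1 s
  | instr (i : Instr) (s : State) : Exec w (.instr i) s 1 (i.exec w s)
  | seq {p q : Prog} {s s' s'' : State} {t t' : ℕ} :
      Exec w p s t s' → Exec w q s' t' s'' → Exec w (.seq p q) s (t + t') s''
  | branch_true {b : Test} {p q : Prog} {s s' : State} {t : ℕ} :
      b.Holds s → Exec w p s t s' → Exec w (.branch b p q) s (t + 1) s'
  | branch_false {b : Test} {p q : Prog} {s s' : State} {t : ℕ} :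
      ¬ b.Holds s → Exec w q s t s' → Exec w (.branch b p q) s (t + 1) s'
  | loop_false {b : Test} {p : Prog} {s : State} :
      ¬ b.Holds s → Exec w (.loop b p) s 1 s
  | loop_true {b : Test} {p : Prog} {s s' s'' : State} {t t' : ℕ} :
      b.Holds s → Exec w p s t s' → Exec w (.loop b p) s' t' s'' →
      Exec w (.loop b p) s (t + t' + 1) s''

open Classical in
/-- The input state for a graph with vertices `0, …, n - 1`: register `0` holds `n`, the memory
cells `0, …, n² - 1` hold the adjacency matrix row by row, and everything else is `0`. -/
noncomputable def graphInput {n : ℕ} (G : SimpleGraph (Fin n)) : State where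
  reg r := if r = 0 then n else 0
  mem a := if ∃ u v : Fin n, a = u * n + v ∧ G.Adj u v then 1 else 0

/-- The output list in a state: register `0` holds its length, and register `1` the address of the
first of the consecutive memory cells that hold its entries. -/
def State.output (s : State) : List ℕ :=
  (List.range (s.reg 0)).map fun i => s.mem (s.reg 1 + i)

end WordRAM

/-!
A connected graph `G` without an induced path on `k` vertices has radius at most `m = ⌊k / 2⌋`, and
`⌈(k + 1) / 2⌉ = m + 1`. Burn `G` greedily from a vertex `c`: the first source is `c`, and every
further source is any vertex that is still unburned, as long as there is one. At time `t` all
vertices at distance less than `t` from `c` burn, so this burning sequence has at most one entry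
more than the eccentricity of `c` (`Burning.IsGreedyFrom.length_le`). The shortest of the sequences
obtained from the `n` possible starting vertices thus has at most `m + 1` entries. No distances have
to be computed, and the simulation of the burning processes takes `O(n ^ 4)` steps.

The bound on the radius is `SimpleGraph.Connected.exists_forall_dist_le`: a connected graph of
radius greater than `m` has an induced path on `2 m + 1` vertices. In a minimal such graph all
vertices except one, `v`, are within distance `m` of some `x`. The induced path consists of two
geodesics of length `m` from `x` (`SimpleGraph.Connected.pathGraph_isIndContained`). Its first end
`u` is chosen with the set `A u` of neighbours of `x` on geodesics from `x` to `u` as small as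
possible, among the vertices at distance `m` from `x` for which all of `A u` is within distance `m`
of `v`; the neighbours of `v` are such vertices. The second end is a vertex `y` further than `m` from
some `p ∈ A u`; it is not `v`, so it is at distance `m` from `x` too. As `p ∉ A y`, minimality of
`A u` gives a neighbour of `x` that is in `A y` but not in `A u`.

The program is `WordRAM.burningProg`. It is verified with rules for total correctness with time
bounds (`WordRAM.Runs`), one loop at a time, up to `WordRAM.burningProg_runs`.
-/

/-! ### Connected graphs without long induced paths have small radius -/

namespace SimpleGraph

variable {V : Type*} {G : SimpleGraph V}

theorem pathGraph_isIndContained_pathGraph {k l : ℕ} (h : k ≤ l) :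
    (pathGraph k).IsIndContained (pathGraph l) :=
  ⟨⟨Fin.castLEEmb h, by simp [pathGraph_adj]⟩⟩

theorem Connected.dist_le_succ_of_adj (hG : G.Connected) {u v : V} (h : G.Adj u v) (w : V) :
    G.dist u w ≤ G.dist v w + 1 := by
  have h1 := hG.dist_triangle (u := u) (v := v) (w := w)
  have h2 := dist_eq_one_iff_adj.2 h
  omega

theorem Connected.exists_geodesic (hG : G.Connected) (u v : V) :
    ∃ f : ℕ → V, f 0 = u ∧ f (G.dist u v) = v ∧
      (∀ i < G.dist u v, G.Adj (f i) (f (i + 1))) ∧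
      ∀ i ≤ G.dist u v, G.dist u (f i) = i ∧ G.dist (f i) v = G.dist u v - i := by
  obtain ⟨p, hp⟩ := hG.exists_walk_length_eq_dist u v
  refine ⟨p.getVert, by simp, by simp [← hp], fun i hi => p.adj_getVert_succ (by omega),
    fun i hi => ?_⟩
  have h1 := G.dist_le (p.take i)
  have h2 := G.dist_le (p.drop i)
  have h3 := hG.dist_triangle (u := u) (v := p.getVert i) (w := v)
  rw [Walk.take_length] at h1
  rw [Walk.drop_length] at h2
  omega

/-- Two geodesics of length `m` from a common vertex `x`, with no edge and no common vertex apart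
from `x`, form an induced path. -/
theorem pathGraph_isIndContained_of_geodesics {x : V} {m : ℕ} {P Q : ℕ → V}
    (hP0 : P 0 = x) (hQ0 : Q 0 = x)
    (hP : ∀ i < m, G.Adj (P i) (P (i + 1))) (hQ : ∀ i < m, G.Adj (Q i) (Q (i + 1)))
    (hPd : ∀ i ≤ m, G.dist x (P i) = i) (hQd : ∀ i ≤ m, G.dist x (Q i) = i)
    (hne : ∀ i j, 1 ≤ i → i ≤ m → 1 ≤ j → j ≤ m → P i ≠ Q j ∧ ¬ G.Adj (P i) (Q j)) :
    (pathGraph (2 * m + 1)).IsIndContained G := by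
  have hlayer : ∀ {R : ℕ → V}, (∀ i ≤ m, G.dist x (R i) = i) → ∀ i j, i ≤ m → j ≤ m →
      G.Adj (R i) (R j) → i = j + 1 ∨ j = i + 1 := by
    intro R hR i j hi hj h
    have h1 := h.diff_dist_adj (u := x)
    rw [hR i hi, hR j hj] at h1
    have h2 : i ≠ j := by rintro rfl; exact h.ne rfl
    omega
  have hinj : ∀ {R : ℕ → V}, (∀ i ≤ m, G.dist x (R i) = i) → ∀ i j, i ≤ m → j ≤ m →
      R i = R j → i = j := by
    intro R hR i j hi hj h
    rw [← hR i hi, h, hR j hj]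
  let f : Fin (2 * m + 1) → V := fun i => if (i : ℕ) ≤ m then Q (m - i) else P (i - m)
  have hf1 : ∀ i : Fin (2 * m + 1), (i : ℕ) ≤ m → f i = Q (m - i) := fun i h => if_pos h
  have hf2 : ∀ i : Fin (2 * m + 1), m ≤ (i : ℕ) → f i = P (i - m) := by
    intro i h
    rcases h.eq_or_lt with h | h
    · rw [hf1 i h.ge, ← h]; simp [hP0, hQ0]
    · exact if_neg (by omega)
  -- A pair of indices lies in one half of the path, or strictly on the two sides of `m`.
  have hcases : ∀ i j : Fin (2 * m + 1), ((i : ℕ) ≤ m ∧ (j : ℕ) ≤ m) ∨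
      (m ≤ (i : ℕ) ∧ m ≤ (j : ℕ)) ∨ ((i : ℕ) < m ∧ m < (j : ℕ)) ∨ (m < (i : ℕ) ∧ (j : ℕ) < m) := by
    intro i j; omega
  refine ⟨⟨⟨f, ?_⟩, ?_⟩⟩
  · intro i j hij
    have hi := i.isLt
    have hj := j.isLt
    rcases hcases i j with h | h | h | h
    · rw [hf1 i h.1, hf1 j h.2] at hij
      have := hinj hQd _ _ (by omega) (by omega) hij
      omega
    · rw [hf2 i h.1, hf2 j h.2] at hij
      have := hinj hPd _ _ (by omega) (by omega) hij
      omega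
    · rw [hf1 i h.1.le, hf2 j h.2.le] at hij
      exact absurd hij.symm (hne _ _ (by omega) (by omega) (by omega) (by omega)).1
    · rw [hf2 i h.1.le, hf1 j h.2.le] at hij
      exact absurd hij (hne _ _ (by omega) (by omega) (by omega) (by omega)).1
  · intro i j
    have hi := i.isLt
    have hj := j.isLt
    change G.Adj (f i) (f j) ↔ (pathGraph (2 * m + 1)).Adj i j
    rw [pathGraph_adj]
    rcases hcases i j with h | h | h | h
    · rw [hf1 i h.1, hf1 j h.2]
      constructor
      · intro hij
        have := hlayer hQd _ _ (by omega) (by omega) hij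
        omega
      · rintro (hij | hij)
        · have := hQ (m - j) (by omega)
          rw [show m - (j : ℕ) + 1 = m - i by omega] at this
          exact this.symm
        · have := hQ (m - i) (by omega)
          rwa [show m - (i : ℕ) + 1 = m - j by omega] at this
    · rw [hf2 i h.1, hf2 j h.2]
      constructor
      · intro hij
        have := hlayer hPd _ _ (by omega) (by omega) hij
        omega
      · rintro (hij | hij)
        · have := hP (i - m) (by omega)
          rwa [show (i : ℕ) - m + 1 = j - m by omega] at this
        · have := hP (j - m) (by omega)
          rw [show (j : ℕ) - m + 1 = i - m by omega] at this
          exact this.symm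
    · rw [hf1 i h.1.le, hf2 j h.2.le]
      refine iff_of_false (fun hij => ?_) (by omega)
      exact (hne (j - m) (m - i) (by omega) (by omega) (by omega) (by omega)).2 hij.symm
    · rw [hf2 i h.1.le, hf1 j h.2.le]
      refine iff_of_false (fun hij => ?_) (by omega)
      exact (hne (i - m) (m - j) (by omega) (by omega) (by omega) (by omega)).2 hij

/-- Let `w` and `y` be at distance `m` from `x`, let `p` and `q` be neighbours of `x` on geodesics
to `w` and `y`. If `p` is further from `y` than `x` is, and `q` is not on a geodesic from `x` to
`w`, then the two geodesics form an induced path: any other edge between them would give a short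
path from `p` to `y` or from `q` to `w`. -/
theorem Connected.pathGraph_isIndContained (hG : G.Connected) {x w y p q : V} {m : ℕ}
    (hw : G.dist x w = m + 1) (hy : G.dist x y = m + 1) (hxp : G.Adj x p) (hxq : G.Adj x q)
    (hpw : G.dist p w ≤ m) (hqy : G.dist q y ≤ m) (hpy : m + 2 ≤ G.dist p y)
    (hqw : m < G.dist q w) :
    (pathGraph (2 * (m + 1) + 1)).IsIndContained G := by
  have hpw' : G.dist p w = m := by
    have := hG.dist_le_succ_of_adj hxp w
    omega
  have hqy' : G.dist q y = m := by
    have := hG.dist_le_succ_of_adj hxq y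
    omega
  have key : ∀ {a b : V}, G.Adj x a → G.dist a b = m → G.dist x b = m + 1 →
      ∃ P : ℕ → V, P 0 = x ∧ (∀ i < m + 1, G.Adj (P i) (P (i + 1))) ∧
        (∀ i ≤ m + 1, G.dist x (P i) = i) ∧
        ∀ i, 1 ≤ i → i ≤ m + 1 → G.dist a (P i) = i - 1 ∧ G.dist (P i) b = m + 1 - i := by
    intro a b hxa hab hxb
    obtain ⟨f, hf0, hf1, hf2, hf3⟩ := hG.exists_geodesic a b
    rw [hab] at hf1 hf2 hf3
    refine ⟨fun i => if i = 0 then x else f (i - 1), by simp, ?_, ?_, ?_⟩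
    · rintro (_ | i) hi
      · simpa [hf0] using hxa
      · simpa using hf2 i (by omega)
    · rintro (_ | i) hi
      · simp
      · have h1 := hf3 i (by omega)
        have h2 := hG.dist_triangle (u := x) (v := f i) (w := b)
        have h3 := hG.dist_le_succ_of_adj hxa (f i)
        simp only [Nat.add_eq_zero_iff, one_ne_zero, and_false, if_false, Nat.add_sub_cancel]
        omega
    · rintro (_ | i) h1 hi
      · omega
      · have h1 := hf3 i (by omega)
        simpa using h1
  obtain ⟨P, hP0, hP, hPd, hPd'⟩ := key hxp hpw' hw
  obtain ⟨Q, hQ0, hQ, hQd, hQd'⟩ := key hxq hqy' hy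
  refine pathGraph_isIndContained_of_geodesics hP0 hQ0 hP hQ hPd hQd ?_
  intro i j hi hi' hj hj'
  have h1 := hPd i hi'
  have h2 := hQd j hj'
  have h3 := hPd' i hi hi'
  have h4 := hQd' j hj hj'
  have h5 := hG.dist_triangle (u := p) (v := P i) (w := y)
  constructor
  · intro h
    rw [← h] at h2 h4
    omega
  · intro h
    have h6 := hG.dist_le_succ_of_adj h y
    have h7 := h.diff_dist_adj (u := x)
    have h8 := hG.dist_le_succ_of_adj h.symm w
    have h9 := hG.dist_triangle (u := q) (v := Q j) (w := w)
    omega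

/-- A connected graph without an induced path on `2 m + 1` vertices has radius at most `m`.
By induction it may be assumed that all vertices but one, `v`, are within distance `m` of `x`.
If every vertex has another one at distance greater than `m`, then among the `w` at distance `m`
from `x` such that every neighbour of `x` on a geodesic to `w` is within distance `m` of `v`, one
for which the number of these neighbours is least leads to an induced path. -/
theorem Connected.exists_forall_dist_le [Finite V] (hG : G.Connected) {m : ℕ}
    (hfree : ¬ (pathGraph (2 * m + 1)).IsIndContained G) :
    ∃ x, ∀ v, G.dist x v ≤ m := by
  suffices H : ∀ (N : ℕ) (V : Type _) [Finite V] (G : SimpleGraph V), Nat.card V = N →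
      G.Connected → ¬ (pathGraph (2 * m + 1)).IsIndContained G → ∃ x, ∀ v, G.dist x v ≤ m from
    H _ V G rfl hG hfree
  intro N
  induction N with
  | zero =>
    intro V _ G hV hG _
    have := hG.nonempty
    exact absurd hV Nat.card_pos.ne'
  | succ N ih =>
    intro V _ G hV hG hfree
    by_contra! hfar
    rcases subsingleton_or_nontrivial V with hs | hn
    · obtain ⟨x⟩ := hG.nonempty
      obtain ⟨y, hy⟩ := hfar x
      simp [Subsingleton.elim y x] at hy
    obtain ⟨v, hv⟩ := hG.exists_connected_induce_compl_singleton_of_finite_nontrivial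
    have hcard : Nat.card ({v}ᶜ : Set V) = N := by
      have := Set.ncard_add_ncard_compl ({v} : Set V)
      rw [Set.ncard_singleton, hV] at this
      rw [Nat.card_coe_set_eq]
      omega
    obtain ⟨⟨x, hxv⟩, hx⟩ := ih ({v}ᶜ : Set V) (G.induce {v}ᶜ) hcard hv
      (fun h => hfree (h.trans ⟨Embedding.induce _⟩))
    have hx' : ∀ u, u ≠ v → G.dist x u ≤ m := by
      intro u hu
      refine le_trans ?_ (hx ⟨u, hu⟩)
      obtain ⟨p, hp⟩ := hv.exists_walk_length_eq_dist ⟨x, hxv⟩ ⟨u, hu⟩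
      rw [← hp, ← Walk.length_map (Embedding.induce _).toHom]
      exact dist_le _
    have hxv' : m + 1 ≤ G.dist x v := by
      obtain ⟨u, hu⟩ := hfar x
      by_cases h : u = v
      · exact h ▸ hu
      · exact absurd (hx' u h) (by omega)
    obtain ⟨w, hvw⟩ : ∃ w, G.Adj v w := hG.preconnected.exists_adj_of_nontrivial v
    have hw : G.dist x w = m := by
      have h1 := hx' w hvw.ne'
      have h2 := hvw.diff_dist_adj (u := x)
      omega
    rcases m with _ | m
    · have : Subsingleton (Fin (2 * 0 + 1)) := inferInstanceAs (Subsingleton (Fin 1))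
      exact hfree ⟨⟨⟨fun _ => x, fun i j _ => Subsingleton.elim _ _⟩, by
        intro i j; simp [Subsingleton.elim i j]⟩⟩
    -- `A u` is the set of neighbours of `x` on geodesics to the vertices `u` of the layer `m + 1`.
    let A : V → Set V := fun u => {p | G.Adj x p ∧ G.dist p u ≤ m}
    let W : Set V := {u | G.dist x u = m + 1 ∧ ∀ p ∈ A u, G.dist p v ≤ m + 1}
    have hwW : w ∈ W := ⟨hw, fun p hp => by
      have h1 := hG.dist_le_succ_of_adj hvw p
      rw [dist_comm, dist_comm (u := w)] at h1
      exact h1.trans (Nat.add_le_add_right hp.2 1)⟩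
    obtain ⟨u, huW, humin⟩ := Set.exists_min_image W (fun u => (A u).ncard) (Set.toFinite _) ⟨w, hwW⟩
    obtain ⟨p, hp⟩ : (A u).Nonempty := by
      obtain ⟨f, hf0, hf1, hf2, hf3⟩ := hG.exists_geodesic x u
      rw [huW.1] at hf1 hf2 hf3
      exact ⟨f 1, by simpa [hf0] using hf2 0 (by omega), by have := hf3 1 (by omega); omega⟩
    obtain ⟨y, hy⟩ := hfar p
    have hyv : y ≠ v := by
      rintro rfl
      exact absurd (huW.2 p hp) (by omega)
    have hxy : G.dist x y = m + 1 := by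
      have h1 := hx' y hyv
      have h2 := hG.dist_le_succ_of_adj hp.1.symm y
      omega
    by_cases hsub : A y ⊆ A u
    · have hyW : y ∈ W := ⟨hxy, fun a ha => huW.2 a (hsub ha)⟩
      refine absurd (humin y hyW) (not_le.2 (Set.ncard_lt_ncard ⟨hsub, fun h => ?_⟩ (Set.toFinite _)))
      have := (h hp).2
      omega
    · obtain ⟨q, hq, hqu⟩ := Set.not_subset.1 hsub
      exact hfree (hG.pathGraph_isIndContained huW.1 hxy hp.1 hq.1 hp.2 hq.2 (by omega)
        (not_le.1 fun h => hqu ⟨hq.1, h⟩))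

end SimpleGraph

/-! ### Greedy burning -/

namespace Burning

variable {V : Type*} {G : SimpleGraph V}

theorem burned_subset_succ (B : List V) (t : ℕ) : burned G B t ⊆ burned G B (t + 1) :=
  fun _ hv => Or.inl hv

theorem burned_mono (B : List V) : Monotone (burned G B) :=
  monotone_nat_of_le_succ (burned_subset_succ B)

/-- The sources at times later than `t` do not matter at time `t`. -/
theorem burned_append (B C : List V) : ∀ t ≤ B.length, burned G (B ++ C) t = burned G B t
  | 0, _ => rfl
  | t + 1, ht => by
    have ih := burned_append B C t (by omega)
    simp only [burned, ih, List.getElem?_append_left (show t < B.length by omega)]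

/-- The vertices burned at the next time, if those in `X` are burned now and the next source is
`x`. -/
def nextBurned (G : SimpleGraph V) (X : Set V) (x : V) : Set V :=
  {v | v ∈ X ∨ (∃ u ∈ X, G.Adj u v) ∨ x = v}

theorem burned_append_singleton (B : List V) (x : V) :
    burned G (B ++ [x]) (B ++ [x]).length = nextBurned G (burned G B B.length) x := by
  rw [List.length_append, List.length_singleton, burned, burned_append B [x] _ le_rfl]
  simp [nextBurned]

theorem mem_burned_of_mem {B : List V} {v : V} (hv : v ∈ B) : v ∈ burned G B B.length := by
  obtain ⟨i, hi, rfl⟩ := List.getElem_of_mem hv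
  exact burned_mono B (show i + 1 ≤ B.length from hi) (Or.inr (Or.inr (by simp [hi])))

theorem exists_edist_le_of_mem_burned {B : List V} : ∀ {t : ℕ} {v : V}, v ∈ burned G B t →
    ∃ i : Fin B.length, (i : ℕ) < t ∧ G.edist v (B.get i) ≤ ((t - ((i : ℕ) + 1) : ℕ) : ℕ∞)
  | t + 1, v, hv => by
    have hcast : ∀ i : ℕ, i < t → ((t - (i + 1) : ℕ) : ℕ∞) + 1 = ((t + 1 - (i + 1) : ℕ) : ℕ∞) := by
      intro i hi
      exact_mod_cast congrArg (Nat.cast (R := ℕ∞)) (show t - (i + 1) + 1 = t + 1 - (i + 1) by omega)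
    rcases hv with hv | ⟨u, hu, huv⟩ | hv
    · obtain ⟨i, hi, h⟩ := exists_edist_le_of_mem_burned hv
      exact ⟨i, by omega, h.trans (by rw [← hcast i hi]; exact le_self_add)⟩
    · obtain ⟨i, hi, h⟩ := exists_edist_le_of_mem_burned hu
      refine ⟨i, by omega, ?_⟩
      rw [← hcast i hi, add_comm]
      refine SimpleGraph.edist_triangle.trans (add_le_add ?_ h)
      exact (SimpleGraph.edist_eq_one_iff_adj.2 huv.symm).le
    · obtain ⟨ht, rfl⟩ := List.getElem?_eq_some_iff.1 hv
      exact ⟨⟨t, ht⟩, by simp, by simp⟩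

theorem mem_burned_of_dist_lt (hG : G.Connected) {B : List V} {c : V} (hc : B[0]? = some c) :
    ∀ {t : ℕ} {v : V}, G.dist c v < t → v ∈ burned G B t
  | 0, _, h => absurd h (by omega)
  | t + 1, v, h => by
    by_cases hcv : c = v
    · subst hcv
      exact burned_mono B (show 1 ≤ t + 1 by omega) (Or.inr (Or.inr hc))
    obtain ⟨p, hp⟩ := hG.exists_walk_length_eq_dist c v
    have hnil : ¬ p.Nil := fun h => hcv h.eq
    have h1 := G.dist_le p.dropLast
    have h2 : 0 < G.dist c v := hG.pos_dist_of_ne hcv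
    have h3 : p.dropLast.length = p.length - 1 := by simp [SimpleGraph.Walk.dropLast]
    exact Or.inr (Or.inl ⟨p.penultimate, mem_burned_of_dist_lt hG hc (by omega),
      p.adj_penultimate hnil⟩)

/-- `B` is a sequence of legal choices in the burning process that starts with `c`, unless it is
empty. -/
structure IsGreedyFrom (G : SimpleGraph V) (c : V) (B : List V) : Prop where
  head : ∀ b, B[0]? = some b → b = c
  notMem_burned : ∀ i : Fin B.length, B.get i ∉ burned G B i
  nodup : B.Nodup

theorem IsGreedyFrom.nil (c : V) : IsGreedyFrom G c [] := ⟨by simp, fun i => i.elim0, by simp⟩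

theorem IsGreedyFrom.append {c x : V} {B : List V} (h : IsGreedyFrom G c B)
    (hx : x ∉ burned G B B.length) (hc : B = [] → x = c) : IsGreedyFrom G c (B ++ [x]) where
  head := by
    rcases B with _ | ⟨b, B⟩
    · simpa using hc
    · simpa using h.head
  notMem_burned := by
    rintro ⟨i, hi⟩
    have hi' : i ≤ B.length := by simpa [Nat.lt_succ_iff] using hi
    rw [burned_append B [x] i hi']
    rcases hi'.eq_or_lt with rfl | hlt
    · simpa using hx
    · simpa [hlt, List.getElem_append_left hlt] using h.notMem_burned ⟨i, hlt⟩
  nodup := by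
    rw [List.nodup_append]
    refine ⟨h.nodup, by simp, ?_⟩
    rintro a ha b hb rfl
    rw [List.mem_singleton.1 hb] at ha
    exact hx (mem_burned_of_mem ha)

/-- The fire started at `c` burns everything in time; so a legal choice at time `B.length + 1` is
possible only as long as `B.length` does not exceed the eccentricity of `c`. -/
theorem IsGreedyFrom.length_le (hG : G.Connected) {c x : V} {B : List V} {m : ℕ}
    (h : IsGreedyFrom G c B) (hx : x ∉ burned G B B.length) (hm : ∀ v, G.dist c v ≤ m) :
    B.length ≤ m := by
  by_contra! hlt
  have h0 : B[0]? = some c := by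
    rw [List.getElem?_eq_getElem (by omega), h.head _ (List.getElem?_eq_getElem (by omega))]
  exact hx (mem_burned_of_dist_lt hG h0 ((hm x).trans_lt hlt))

theorem IsGreedyFrom.isBurningSequence {c : V} {B : List V} (h : IsGreedyFrom G c B)
    (hB : ∀ v, v ∈ burned G B B.length) : IsBurningSequence G B :=
  ⟨h.notMem_burned, fun v => (exists_edist_le_of_mem_burned (hB v)).imp fun _ hi => hi.2⟩

end Burning

/-! ### Total correctness with time bounds -/

namespace WordRAM

/-- On a machine with words of `w` bits, `p` started in `s` halts within `T` steps in a state that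
satisfies `Q`. -/
def Runs (w : ℕ) (p : Prog) (T : ℕ) (s : State) (Q : State → Prop) : Prop :=
  ∃ t s', Exec w p s t s' ∧ t ≤ T ∧ Q s'

variable {w : ℕ} {p q : Prog} {b : Test} {T T' : ℕ} {s : State} {Q R : State → Prop}

theorem Runs.mono (h : Runs w p T s Q) (hT : T ≤ T') (hQ : ∀ s', Q s' → R s') :
    Runs w p T' s R := by
  obtain ⟨t, s', h1, h2, h3⟩ := h
  exact ⟨t, s', h1, h2.trans hT, hQ s' h3⟩

theorem Runs.seq (hp : Runs w p T s Q) (hq : ∀ s', Q s' → Runs w q T' s' R) :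
    Runs w (.seq p q) (T + T') s R := by
  obtain ⟨t, s', h1, h2, h3⟩ := hp
  obtain ⟨t', s'', h4, h5, h6⟩ := hq s' h3
  exact ⟨t + t', s'', .seq h1 h4, by omega, h6⟩

theorem Runs.branch (hp : b.Holds s → Runs w p T s Q) (hq : ¬ b.Holds s → Runs w q T s Q) :
    Runs w (.branch b p q) (T + 1) s Q := by
  by_cases hb : b.Holds s
  · obtain ⟨t, s', h1, h2, h3⟩ := hp hb
    exact ⟨t + 1, s', .branch_true hb h1, by omega, h3⟩
  · obtain ⟨t, s', h1, h2, h3⟩ := hq hb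
    exact ⟨t + 1, s', .branch_false hb h1, by omega, h3⟩

/-- The rule for loops: `I` is an invariant and `μ` decreases, so there are at most `μ s` rounds. -/
theorem Runs.loop (I : State → Prop) (μ : State → ℕ)
    (h : ∀ s, I s → b.Holds s → Runs w p T s fun s' => I s' ∧ μ s' < μ s) (hs : I s) :
    Runs w (.loop b p) (μ s * (T + 1) + 1) s fun s' => I s' ∧ ¬ b.Holds s' := by
  induction hN : μ s using Nat.strong_induction_on generalizing s with
  | _ N ih =>
    by_cases hb : b.Holds s
    · obtain ⟨t, s', h1, h2, h3, h4⟩ := h s hs hb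
      obtain ⟨t', s'', h5, h6, h7⟩ := ih (μ s') (hN ▸ h4) h3 rfl
      refine ⟨t + t' + 1, s'', .loop_true hb h1 h5, ?_, h7⟩
      have h8 : (μ s' + 1) * (T + 1) ≤ N * (T + 1) := Nat.mul_le_mul_right _ (hN ▸ h4)
      rw [add_mul] at h8
      omega
    · exact ⟨1, s, .loop_false hb, by omega, hs, hb⟩

/-- The program that carries out the instructions in a list. -/
def block : List Instr → Prog
  | [] => .skip
  | i :: l => .seq (.instr i) (block l)

/-- Effect of the instructions in a list. -/
def execList (w : ℕ) : List Instr → State → State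
  | [], s => s
  | i :: l, s => execList w l (i.exec w s)

theorem exec_block (w : ℕ) : ∀ (l : List Instr) (s : State),
    Exec w (block l) s (l.length + 1) (execList w l s)
  | [], s => .skip s
  | i :: l, s => by
    rw [List.length_cons, add_comm l.length 1, add_assoc]
    exact .seq (.instr i s) (exec_block w l _)

theorem Runs.block {l : List Instr} (hT : l.length + 1 ≤ T) (h : Q (execList w l s)) :
    Runs w (block l) T s Q :=
  ⟨_, _, exec_block w l s, hT, h⟩

end WordRAM

/-! ### The program -/

/-! ### A program that burns graphs greedily -/

namespace WordRAM

open Burning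

/-- Add to register `14` the number of neighbours of the vertex in register `13` that are marked in
the array at the address in register `9`. -/
def scanProg : Prog :=
  .loop (.lt 15 0) (block [.add 16 9 15, .load 17 16, .mul 16 15 0, .add 16 16 13, .load 18 16,
    .mul 17 17 18, .add 14 14 17, .add 15 15 3])

/-- Decide whether the vertex `v` in register `13` burns after the current step, mark it accordingly
in the array at the address in register `11`, and if it does not burn, put it in register `12`. -/
def vertexProg : Prog :=
  .seq (block [.add 16 9 13, .load 14 16, .const 15 0])
  (.seq scanProg
  (.seq (.branch (.eq 13 10) (block [.add 14 14 3]) .skip)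
  (.seq (block [.add 16 11 13])
  (.seq (.branch (.lt 4 14) (block [.store 16 3]) (block [.store 16 4, .move 12 13]))
    (block [.add 13 13 3])))))

/-- One step of the burning process: the vertex in register `10` becomes the next source. -/
def stepProg : Prog :=
  .seq (block [.add 16 7 8, .store 16 10, .add 8 8 3, .add 11 9 0, .move 12 0, .const 13 0])
  (.seq (.loop (.lt 13 0) vertexProg)
    (block [.move 9 11, .move 10 12]))

/-- Burn the graph greedily, starting with the vertex in register `5`. -/
def greedyProg : Prog :=
  .seq (block [.const 8 0, .move 9 6, .move 10 5]) (.loop (.lt 10 0) stepProg)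

/-- Burn the graph greedily from each vertex, and return the shortest sequence.
The registers:
* `0`: the number `n` of vertices, and at the end the length of the output;
* `1`, `2`: address and length of the best sequence so far;
* `3`, `4`: the constants `1` and `0`;
* `5`: the starting vertex `c`;
* `6`: the address `2 n²` of an array of `n` zeros;
* `7`: the address `n² + c n` of the current sequence;
* `8`: its length `t`;
* `9`: the address `2 n² + t n` of the array that marks the vertices burned at time `t`;
* `10`: the next source, or `n` if all vertices burn;
* `11`, `12`: what registers `9` and `10` will be after the current step;
* `13`: a vertex `v`;
* `14`: a number that is positive if and only if `v` burns after the current step;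
* `15`: a vertex `u`, a possible neighbour of `v`;
* `16`, `17`, `18`: intermediate results. -/
def burningProg : Prog :=
  .seq (block [.const 3 1, .mul 7 0 0, .add 6 7 7, .add 2 0 3])
  (.seq (.loop (.lt 5 0)
    (.seq greedyProg
    (.seq (.branch (.lt 8 2) (block [.move 2 8, .move 1 7]) .skip)
      (block [.add 7 7 0, .add 5 5 3]))))
    (block [.move 0 2]))

open Classical in
/-- The memory of `s` contains at `a` the indicator array of the set `X`. -/
def State.Marks {n : ℕ} (s : State) (a : ℕ) (X : Set (Fin n)) : Prop :=
  ∀ v : Fin n, s.mem (a + v) = if v ∈ X then 1 else 0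

open Classical in
/-- The memory of `s` starts with the adjacency matrix of `G`. -/
def State.HasAdj {n : ℕ} (s : State) (G : SimpleGraph (Fin n)) : Prop :=
  ∀ u v : Fin n, s.mem (u * n + v) = if G.Adj u v then 1 else 0

theorem _root_.Fin.mul_add_lt {n : ℕ} (u v : Fin n) : (u : ℕ) * n + v < n * n := by
  have h1 := Nat.mul_le_mul_right n u.isLt
  have h2 := v.isLt
  rw [Nat.succ_mul] at h1
  omega

theorem State.Marks.congr {n : ℕ} {s s' : State} {a : ℕ} {X : Set (Fin n)} (h : s.Marks a X)
    (hs : ∀ i < n, s'.mem (a + i) = s.mem (a + i)) : s'.Marks a X :=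
  fun v => (hs v v.isLt).trans (h v)

theorem State.HasAdj.congr {n : ℕ} {s s' : State} {G : SimpleGraph (Fin n)} (h : s.HasAdj G)
    (hs : ∀ i < n * n, s'.mem i = s.mem i) : s'.HasAdj G :=
  fun u v => (hs _ (u.mul_add_lt v)).trans (h u v)

theorem hasAdj_graphInput {n : ℕ} (G : SimpleGraph (Fin n)) : (graphInput G).HasAdj G := by
  intro u v
  simp only [graphInput]
  congr 1
  refine propext ⟨?_, fun h => ⟨u, v, rfl, h⟩⟩
  rintro ⟨u', v', h, hadj⟩
  have hn : 0 < n := u.pos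
  have h1 := congrArg (· / n) h
  have h2 := congrArg (· % n) h
  simp only [Nat.mul_add_mod', Nat.mod_eq_of_lt v.isLt, Nat.mod_eq_of_lt v'.isLt] at h2
  simp only [mul_comm _ n, Nat.mul_add_div hn, Nat.div_eq_of_lt v.isLt, Nat.div_eq_of_lt v'.isLt,
    add_zero] at h1
  rwa [Fin.ext h1, Fin.ext h2]

/-! ### Correctness and running time of the program -/

section

variable {n w : ℕ} {G : SimpleGraph (Fin n)} {s : State}

/-- The assumption on `w` ensures that all numbers that occur fit into a word; the largest are
addresses, below `3 n² + 2 n`. -/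
theorem scanProg_runs (hw : 4 * (n * n) + 4 * n + 4 < 2 ^ w) {X : Set (Fin n)} {v : Fin n}
    (hadj : s.HasAdj G) (hX : s.Marks (s.reg 9) X) (h0 : s.reg 0 = n) (h3 : s.reg 3 = 1)
    (h9 : s.reg 9 ≤ 3 * (n * n)) (h13 : s.reg 13 = v) (h15 : s.reg 15 = 0)
    (hv : s.reg 14 ≤ 1) (hv' : 0 < s.reg 14 ↔ v ∈ X) :
    Runs w scanProg (10 * n + 1) s fun s' => s'.mem = s.mem ∧ (∀ r < 14, s'.reg r = s.reg r) ∧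
      s'.reg 14 ≤ n + 1 ∧ (0 < s'.reg 14 ↔ v ∈ X ∨ ∃ u ∈ X, G.Adj u v) := by
  have := Runs.loop (w := w) (b := .lt 15 0) (T := 9) (s := s)
    (p := block [.add 16 9 15, .load 17 16, .mul 16 15 0, .add 16 16 13, .load 18 16,
      .mul 17 17 18, .add 14 14 17, .add 15 15 3])
    (fun s' => s'.mem = s.mem ∧ (∀ r < 14, s'.reg r = s.reg r) ∧ s'.reg 15 ≤ n ∧
      s'.reg 14 ≤ s'.reg 15 + 1 ∧
      (0 < s'.reg 14 ↔ v ∈ X ∨ ∃ u ∈ X, (u : ℕ) < s'.reg 15 ∧ G.Adj u v))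
    (fun s' => n - s'.reg 15) ?_ ?_
  · refine this.mono (by simp [h15]; omega) ?_
    rintro s' ⟨⟨hm, hr, h1, h2, h3⟩, h4⟩
    refine ⟨hm, hr, by omega, ?_⟩
    simp only [Test.Holds, hr 0 (by omega), h0, not_lt] at h4
    rw [h3]
    simp [fun u : Fin n => u.isLt.trans_le h4]
  · rintro s' ⟨hm, hr, h1, h2, hiff⟩ h4
    simp only [Test.Holds, hr 0 (by omega), h0] at h4
    obtain ⟨u, hu⟩ : ∃ u : Fin n, s'.reg 15 = u := ⟨⟨_, h4⟩, rfl⟩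
    have huv := u.mul_add_lt v
    have hv := v.isLt
    rw [hu] at h1 h2 hiff
    have hX' : s.mem (s.reg 9 + u) ≤ 1 := by rw [hX]; split_ifs <;> simp
    have hG' : s.mem (u * n + v) ≤ 1 := by rw [hadj]; split_ifs <;> simp
    have hle := Nat.mul_le_mul hX' hG'
    have hpos : 0 < s.mem (s.reg 9 + u) * s.mem (u * n + v) ↔ u ∈ X ∧ G.Adj u v := by
      rw [hX, hadj]; split_ifs <;> simp_all
    apply Runs.block (by simp)
    have e14 : (execList w [.add 16 9 15, .load 17 16, .mul 16 15 0, .add 16 16 13, .load 18 16,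
      .mul 17 17 18, .add 14 14 17, .add 15 15 3] s').reg 14 =
        s'.reg 14 + s.mem (s.reg 9 + u) * s.mem (u * n + v) := by
      simp (disch := omega) [execList, Instr.exec, State.setReg, hm, hu, hr 0, hr 9, hr 13, h0, h13,
        Nat.mod_eq_of_lt]
    have e15 : (execList w [.add 16 9 15, .load 17 16, .mul 16 15 0, .add 16 16 13, .load 18 16,
      .mul 17 17 18, .add 14 14 17, .add 15 15 3] s').reg 15 = u + 1 := by
      simp (disch := omega) [execList, Instr.exec, State.setReg, hm, hu, hr 3, h3, Nat.mod_eq_of_lt]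
    refine ⟨⟨?_, ?_, by omega, by omega, ?_⟩, by omega⟩
    · simp [execList, Instr.exec, State.setReg, hm]
    · intro r hrlt
      rw [← hr r hrlt]
      simp (disch := omega) [execList, Instr.exec, State.setReg, Function.update_of_ne]
    · rw [e14, e15, Nat.add_pos_iff_pos_or_pos, hiff, hpos, or_assoc]
      refine or_congr_right ⟨?_, ?_⟩
      · rintro (⟨u', h1, h2, h3⟩ | ⟨h1, h2⟩)
        · exact ⟨u', h1, by omega, h3⟩
        · exact ⟨u, h1, by omega, h2⟩
      · rintro ⟨u', h1, h2, h3⟩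
        rcases Nat.lt_succ_iff_lt_or_eq.1 h2 with h | h
        · exact Or.inl ⟨u', h1, h, h3⟩
        · rw [Fin.ext h] at h1 h3
          exact Or.inr ⟨h1, h3⟩
  · refine ⟨rfl, fun _ _ => rfl, by omega, by omega, ?_⟩
    simp [hv', h15]

open Classical in
/-- The arrays at the addresses in registers `9` and `11` mark the set `X` of the vertices burned now
and the set of those burned at the next time. -/
theorem vertexProg_runs (hw : 4 * (n * n) + 4 * n + 4 < 2 ^ w) {X : Set (Fin n)} {v x : Fin n}
    (hadj : s.HasAdj G) (hX : s.Marks (s.reg 9) X) (h0 : s.reg 0 = n) (h3 : s.reg 3 = 1)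
    (h4 : s.reg 4 = 0) (h9 : s.reg 9 ≤ 3 * (n * n)) (h10 : s.reg 10 = x)
    (h11 : s.reg 11 ≤ 3 * (n * n) + n) (h13 : s.reg 13 = v) :
    Runs w vertexProg (10 * n + 17) s fun s' =>
      s'.mem = Function.update s.mem (s.reg 11 + v) (if v ∈ nextBurned G X x then 1 else 0) ∧
      (∀ r < 12, s'.reg r = s.reg r) ∧ s'.reg 13 = v + 1 ∧
      s'.reg 12 = if v ∈ nextBurned G X x then s.reg 12 else v := by
  have hv := v.isLt
  refine Runs.mono (T := 4 + ((10 * n + 1) + (3 + (2 + (4 + 2))))) (R := _) ?_ (by omega)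
    fun _ h => h
  refine Runs.seq (Q := fun s' => s'.mem = s.mem ∧ (∀ r < 14, s'.reg r = s.reg r) ∧
    s'.reg 14 = s.mem (s.reg 9 + v) ∧ s'.reg 15 = 0) ?_ ?_
  · refine Runs.block (by simp) ⟨?_, ?_, ?_, ?_⟩
    · simp [execList, Instr.exec, State.setReg]
    · intro r hr
      simp (disch := omega) [execList, Instr.exec, State.setReg, Function.update_of_ne]
    · simp (disch := omega) [execList, Instr.exec, State.setReg, h13, Nat.mod_eq_of_lt]
    · simp [execList, Instr.exec, State.setReg]
  rintro s1 ⟨m1, r1, a1, b1⟩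
  refine Runs.seq (Q := fun s' => s'.mem = s.mem ∧ (∀ r < 14, s'.reg r = s.reg r) ∧
    s'.reg 14 ≤ n + 1 ∧ (0 < s'.reg 14 ↔ v ∈ X ∨ ∃ u ∈ X, G.Adj u v)) ?_ ?_
  · refine Runs.mono (scanProg_runs (G := G) (v := v) (X := X) hw ?_ ?_ ?_ ?_ ?_ ?_ b1 ?_ ?_) le_rfl ?_
    · exact hadj.congr fun i _ => by rw [m1]
    · rw [r1 9 (by omega)]
      exact hX.congr fun i _ => by rw [m1]
    · rw [r1 0 (by omega), h0]
    · rw [r1 3 (by omega), h3]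
    · rw [r1 9 (by omega)]; exact h9
    · rw [r1 13 (by omega), h13]
    · rw [a1, hX]; split_ifs <;> simp
    · rw [a1, hX]; split_ifs <;> simp_all
    · rintro s' ⟨h1, h2, h5, h6⟩
      exact ⟨h1.trans m1, fun r hr => (h2 r hr).trans (r1 r hr), h5, h6⟩
  rintro s2 ⟨m2, r2, a2, b2⟩
  refine Runs.seq (Q := fun s' => s'.mem = s.mem ∧ (∀ r < 14, s'.reg r = s.reg r) ∧
    (0 < s'.reg 14 ↔ v ∈ nextBurned G X x)) ?_ ?_
  · refine Runs.branch (T := 2) (fun hb => Runs.block (by simp) ⟨?_, ?_, ?_⟩)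
      (fun hb => ⟨1, s2, .skip _, by omega, m2, r2, ?_⟩)
    · simp [execList, Instr.exec, State.setReg, m2]
    · intro r hr
      rw [← r2 r hr]
      simp (disch := omega) [execList, Instr.exec, State.setReg, Function.update_of_ne]
    · have hxv : x = v := by
        simp only [Test.Holds, r2 13 (by omega), r2 10 (by omega), h13, h10] at hb
        exact Fin.ext hb.symm
      simp (disch := omega) [execList, Instr.exec, State.setReg, r2 3, h3, Nat.mod_eq_of_lt,
        nextBurned, hxv]
    · have hxv : x ≠ v := by
        rintro rfl
        exact hb (by simp only [Test.Holds, r2 13 (by omega), r2 10 (by omega), h13, h10])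
      rw [b2]
      simp [nextBurned, hxv]
  rintro s3 ⟨m3, r3, a3⟩
  refine Runs.seq (Q := fun s' => s'.mem = s.mem ∧ (∀ r < 14, s'.reg r = s.reg r) ∧
    (0 < s'.reg 14 ↔ v ∈ nextBurned G X x) ∧ s'.reg 16 = s.reg 11 + v) ?_ ?_
  · refine Runs.block (by simp) ⟨?_, ?_, ?_, ?_⟩
    · simp [execList, Instr.exec, State.setReg, m3]
    · intro r hr
      rw [← r3 r hr]
      simp (disch := omega) [execList, Instr.exec, State.setReg, Function.update_of_ne]
    · simpa [execList, Instr.exec, State.setReg] using a3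
    · simp (disch := omega) [execList, Instr.exec, State.setReg, r3 11, r3 13, h13,
        Nat.mod_eq_of_lt]
  rintro s4 ⟨m4, r4, a4, b4⟩
  have r4' := fun r (hr : r < 12) => r4 r (by omega)
  refine Runs.seq (Q := fun s' =>
      s'.mem = Function.update s.mem (s.reg 11 + v) (if v ∈ nextBurned G X x then 1 else 0) ∧
      (∀ r < 12, s'.reg r = s.reg r) ∧ s'.reg 13 = v ∧
      s'.reg 12 = if v ∈ nextBurned G X x then s.reg 12 else v) ?_ ?_
  · refine Runs.branch (T := 3) (fun hb => Runs.block (by simp) ?_)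
      (fun hb => Runs.block (by simp) ?_)
    all_goals
      simp only [Test.Holds, r4 4 (by omega), h4, a4] at hb
      simp only [if_pos, hb, if_false]
      refine ⟨?_, ?_, ?_, ?_⟩
    · simp [execList, Instr.exec, State.setMem, m4, b4, r4 3, h3]
    · simpa [execList, Instr.exec, State.setMem] using r4'
    · simp [execList, Instr.exec, State.setMem, r4 13, h13]
    · simp [execList, Instr.exec, State.setMem, r4 12]
    · simp [execList, Instr.exec, State.setMem, State.setReg, m4, b4, r4 4, h4]
    · intro r hr
      rw [← r4' r hr]
      simp (disch := omega) [execList, Instr.exec, State.setReg, State.setMem,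
        Function.update_of_ne]
    · simp [execList, Instr.exec, State.setReg, State.setMem, r4 13, h13]
    · simp [execList, Instr.exec, State.setReg, State.setMem, r4 13, h13]
  rintro s5 ⟨m5, r5, a5, b5⟩
  refine Runs.block (by simp) ⟨?_, ?_, ?_, ?_⟩
  · simp [execList, Instr.exec, State.setReg, m5]
  · intro r hr
    rw [← r5 r hr]
    simp (disch := omega) [execList, Instr.exec, State.setReg, Function.update_of_ne]
  · simp (disch := omega) [execList, Instr.exec, State.setReg, r5 3, h3, a5, Nat.mod_eq_of_lt]
  · simp [execList, Instr.exec, State.setReg, b5]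

open Classical in
/-- One step changes only the cell of the new source and the `n` cells after the array for `X`,
where the array for the next set goes. -/
theorem stepProg_runs (hw : 4 * (n * n) + 4 * n + 4 < 2 ^ w) {X : Set (Fin n)} {x : Fin n}
    (hadj : s.HasAdj G) (hX : s.Marks (s.reg 9) X) (h0 : s.reg 0 = n) (h3 : s.reg 3 = 1)
    (h4 : s.reg 4 = 0) (h7 : n * n ≤ s.reg 7) (h8 : s.reg 8 < n)
    (h79 : s.reg 7 + n ≤ s.reg 9) (h9 : s.reg 9 ≤ 3 * (n * n)) (h10 : s.reg 10 = x) :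
    Runs w stepProg (28 * (n * n) + 28) s fun s' =>
      (∀ a, a ≠ s.reg 7 + s.reg 8 → (a < s.reg 9 + n ∨ s.reg 9 + n + n ≤ a) →
        s'.mem a = s.mem a) ∧
      s'.mem (s.reg 7 + s.reg 8) = x ∧ s'.Marks (s.reg 9 + n) (nextBurned G X x) ∧
      (∀ r < 8, s'.reg r = s.reg r) ∧ s'.reg 8 = s.reg 8 + 1 ∧ s'.reg 9 = s.reg 9 + n ∧
      ((s'.reg 10 = n ∧ ∀ v, v ∈ nextBurned G X x) ∨
        ∃ y : Fin n, s'.reg 10 = y ∧ y ∉ nextBurned G X x) := by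
  have hx := x.isLt
  refine Runs.mono (T := 7 + ((n * ((10 * n + 17) + 1) + 1) + 3)) (R := _) ?_ ?_ fun _ h => h
  swap
  · have h1 : n ≤ n * n := Nat.le_mul_self n
    have h2 : n * ((10 * n + 17) + 1) = 10 * (n * n) + 18 * n := by ring
    omega
  refine Runs.seq (Q := fun s' => s'.mem = Function.update s.mem (s.reg 7 + s.reg 8) x ∧
    (∀ r < 11, r ≠ 8 → s'.reg r = s.reg r) ∧ s'.reg 8 = s.reg 8 + 1 ∧
    s'.reg 11 = s.reg 9 + n ∧ s'.reg 12 = n ∧ s'.reg 13 = 0) ?_ ?_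
  · refine Runs.block (by simp) ⟨?_, ?_, ?_, ?_, ?_, ?_⟩
    · simp (disch := omega) [execList, Instr.exec, State.setReg, State.setMem, h10,
        Nat.mod_eq_of_lt]
    · intro r hr hr8
      simp (disch := omega) [execList, Instr.exec, State.setReg, State.setMem,
        Function.update_of_ne]
    all_goals simp (disch := omega) [execList, Instr.exec, State.setReg, State.setMem, h3, h0,
        Nat.mod_eq_of_lt]
  rintro s1 ⟨m1, r1, a8, a11, a12, a13⟩
  have m1' : ∀ a, a ≠ s.reg 7 + s.reg 8 → s1.mem a = s.mem a := fun a ha => by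
    rw [m1, Function.update_of_ne ha]
  refine Runs.seq (Q := fun s' => (∀ r < 12, s'.reg r = s1.reg r) ∧
    (∀ a, a < s.reg 9 + n ∨ s.reg 9 + n + n ≤ a → s'.mem a = s1.mem a) ∧
    s'.Marks (s.reg 9 + n) (nextBurned G X x) ∧
    ((s'.reg 12 = n ∧ ∀ v, v ∈ nextBurned G X x) ∨
        ∃ y : Fin n, s'.reg 12 = y ∧ y ∉ nextBurned G X x)) ?_ ?_
  · have := Runs.loop (w := w) (b := .lt 13 0) (T := 10 * n + 17) (s := s1) (p := vertexProg)
      (fun s' => (∀ r < 12, s'.reg r = s1.reg r) ∧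
        (∀ a, a < s.reg 9 + n ∨ s.reg 9 + n + n ≤ a → s'.mem a = s1.mem a) ∧
        (∀ v : Fin n, (v : ℕ) < s'.reg 13 →
          s'.mem (s.reg 9 + n + v) = if v ∈ nextBurned G X x then 1 else 0) ∧
        ((s'.reg 12 = n ∧ ∀ v : Fin n, (v : ℕ) < s'.reg 13 → v ∈ nextBurned G X x) ∨
          ∃ y : Fin n, s'.reg 12 = y ∧ y ∉ nextBurned G X x))
      (fun s' => n - s'.reg 13) ?_ ?_
    · refine this.mono (by simp [a13]) ?_
      rintro s' ⟨⟨hr, hm, hF, hp⟩, hb⟩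
      have hlt : ∀ v : Fin n, (v : ℕ) < s'.reg 13 := by
        simp only [Test.Holds, hr 0 (by omega), r1 0 (by omega) (by omega), h0, not_lt] at hb
        exact fun v => v.isLt.trans_le hb
      refine ⟨hr, hm, fun v => hF v (hlt v), hp.imp_left fun h => ⟨h.1, fun v => h.2 v (hlt v)⟩⟩
    · rintro s' ⟨hr, hm, hF, hp⟩ hb
      have hr' : ∀ r < 11, r ≠ 8 → s'.reg r = s.reg r :=
        fun r h h' => (hr r (by omega)).trans (r1 r h h')
      simp only [Test.Holds, hr' 0 (by omega) (by omega), h0] at hb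
      obtain ⟨v, hv⟩ : ∃ v : Fin n, s'.reg 13 = v := ⟨⟨_, hb⟩, rfl⟩
      have e11 : s'.reg 11 = s.reg 9 + n := by rw [hr 11 (by omega), a11]
      have hvlt := v.isLt
      refine Runs.mono (vertexProg_runs (G := G) (X := X) (v := v) (x := x) hw ?_ ?_ ?_ ?_ ?_ ?_ ?_
        ?_ hv) le_rfl ?_
      · exact hadj.congr fun i hi => by rw [hm i (by omega), m1' i (by omega)]
      · rw [hr' 9 (by omega) (by omega)]
        exact hX.congr fun i hi => by rw [hm _ (by omega), m1' _ (by omega)]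
      · rw [hr' 0 (by omega) (by omega), h0]
      · rw [hr' 3 (by omega) (by omega), h3]
      · rw [hr' 4 (by omega) (by omega), h4]
      · rw [hr' 9 (by omega) (by omega)]; exact h9
      · rw [hr' 10 (by omega) (by omega), h10]
      · omega
      · rintro s'' ⟨hm'', hr'', h13, h12⟩
        rw [e11] at hm''
        refine ⟨⟨fun r h => (hr'' r h).trans (hr r h), fun a ha => ?_, fun u hu => ?_, ?_⟩,
          by omega⟩
        · rw [hm'', Function.update_of_ne (by omega), hm a ha]
        · by_cases huv : u = v
          · rw [hm'', huv, Function.update_self]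
          · have huv' : (u : ℕ) ≠ v := fun h => huv (Fin.ext h)
            rw [hm'', Function.update_of_ne (by omega), hF u (by omega)]
        · by_cases hvY : v ∈ nextBurned G X x
          · rw [if_pos hvY] at h12
            rw [h12]
            refine hp.imp_left fun h => ⟨h.1, fun u hu => ?_⟩
            by_cases huv : u = v
            · exact huv ▸ hvY
            · have huv' : (u : ℕ) ≠ v := fun h => huv (Fin.ext h)
              exact h.2 u (by omega)
          · rw [if_neg hvY] at h12
            exact Or.inr ⟨v, h12, hvY⟩
    · exact ⟨fun _ _ => rfl, fun _ _ => rfl, fun v hv => by omega,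
        Or.inl ⟨a12, fun v hv => by omega⟩⟩
  rintro s2 ⟨r2, m2, F2, p2⟩
  refine Runs.block (by simp) ⟨?_, ?_, ?_, ?_, ?_, ?_, ?_⟩
  · intro a h1 h2
    rw [← m1' a h1, ← m2 a h2]
    simp [execList, Instr.exec, State.setReg]
  · simp [execList, Instr.exec, State.setReg, m2 (s.reg 7 + s.reg 8) (by omega), m1]
  · exact F2.congr fun i _ => by simp [execList, Instr.exec, State.setReg]
  · intro r hr
    rw [← r1 r (by omega) (by omega), ← r2 r (by omega)]
    simp (disch := omega) [execList, Instr.exec, State.setReg, Function.update_of_ne]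
  · simp [execList, Instr.exec, State.setReg, r2 8, a8]
  · simp [execList, Instr.exec, State.setReg, r2 11, a11]
  · simpa [execList, Instr.exec, State.setReg] using p2

/-- The invariant of the loop is that register `8` contains the length of a greedy sequence `B`
stored at the address in register `7`, that the array at the address in register `9` marks the
vertices burned so far, and that register `10` contains an unburned vertex or `n`. Since `B` has no
repetitions, there are at most `n` rounds. -/
theorem greedyProg_runs (hw : 4 * (n * n) + 4 * n + 4 < 2 ^ w) {c : Fin n} (hG : G.Connected)
    (hadj : s.HasAdj G) (hZ : s.Marks (2 * (n * n)) (∅ : Set (Fin n))) (h0 : s.reg 0 = n)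
    (h3 : s.reg 3 = 1) (h4 : s.reg 4 = 0) (h5 : s.reg 5 = c) (h6 : s.reg 6 = 2 * (n * n))
    (h7 : n * n ≤ s.reg 7) (h7' : s.reg 7 + n ≤ 2 * (n * n)) :
    Runs w greedyProg (28 * (n * n * n) + 29 * n + 5) s fun s' =>
      (∀ r < 8, s'.reg r = s.reg r) ∧
      (∀ a, a < s.reg 7 ∨ (s.reg 7 + n ≤ a ∧ a < 2 * (n * n) + n) → s'.mem a = s.mem a) ∧
      ∃ B : List (Fin n), s'.reg 8 = B.length ∧ B.length ≤ n ∧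
        (∀ i : Fin B.length, s'.mem (s.reg 7 + i) = B.get i) ∧ IsBurningSequence G B ∧
        ∀ m, (∀ v, G.dist c v ≤ m) → B.length ≤ m + 1 := by
  have hc := c.isLt
  refine Runs.mono (T := 4 + (n * ((28 * (n * n) + 28) + 1) + 1)) (R := _) ?_ ?_ fun _ h => h
  swap
  · have : n * ((28 * (n * n) + 28) + 1) = 28 * (n * n * n) + 29 * n := by ring
    omega
  refine Runs.seq (Q := fun s' => s'.mem = s.mem ∧ (∀ r < 8, s'.reg r = s.reg r) ∧
    s'.reg 8 = 0 ∧ s'.reg 9 = 2 * (n * n) ∧ s'.reg 10 = c) ?_ ?_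
  · refine Runs.block (by simp) ⟨?_, ?_, ?_, ?_, ?_⟩
    · simp [execList, Instr.exec, State.setReg]
    · intro r hr
      simp (disch := omega) [execList, Instr.exec, State.setReg, Function.update_of_ne]
    all_goals simp [execList, Instr.exec, State.setReg, h5, h6]
  rintro s1 ⟨m1, r1, a8, a9, a10⟩
  have := Runs.loop (w := w) (b := .lt 10 0) (T := 28 * (n * n) + 28) (s := s1) (p := stepProg)
    (fun s' => (∀ r < 8, s'.reg r = s.reg r) ∧
      (∀ a, a < s.reg 7 ∨ (s.reg 7 + n ≤ a ∧ a < 2 * (n * n) + n) → s'.mem a = s.mem a) ∧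
      ∃ B : List (Fin n), s'.reg 8 = B.length ∧ s'.reg 9 = 2 * (n * n) + B.length * n ∧
        (∀ i : Fin B.length, s'.mem (s.reg 7 + i) = B.get i) ∧
        s'.Marks (s'.reg 9) (burned G B B.length) ∧ IsGreedyFrom G c B ∧
        (∀ m, (∀ v, G.dist c v ≤ m) → B.length ≤ m + 1) ∧
        ((s'.reg 10 = n ∧ ∀ v, v ∈ burned G B B.length) ∨
          ∃ y : Fin n, s'.reg 10 = y ∧ y ∉ burned G B B.length ∧ (B = [] → y = c)))
    (fun s' => n - s'.reg 8) ?_ ?_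
  · refine this.mono (by simp [a8]) ?_
    rintro s' ⟨⟨hr, hm, B, h8, h9, hS, hF, hB, hlen, hp⟩, hb⟩
    simp only [Test.Holds, hr 0 (by omega), h0, not_lt] at hb
    refine ⟨hr, hm, B, h8, by simpa using hB.nodup.length_le_card, hS, ?_, hlen⟩
    rcases hp with hp | ⟨y, hy, _⟩
    · exact hB.isBurningSequence hp.2
    · exact absurd y.isLt (by omega)
  · rintro s' ⟨hr, hm, B, h8, h9, hS, hF, hB, hlen, hp⟩ hb
    simp only [Test.Holds, hr 0 (by omega), h0] at hb
    obtain ⟨x, h10, hx, hxc⟩ : ∃ y : Fin n, s'.reg 10 = y ∧ y ∉ burned G B B.length ∧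
        (B = [] → y = c) := hp.resolve_left fun h => by omega
    have hBx := hB.append hx hxc
    have hBn : B.length < n := by simpa using hBx.nodup.length_le_card
    have hBn' := Nat.mul_le_mul_right n hBn
    rw [Nat.succ_mul] at hBn'
    refine Runs.mono (stepProg_runs (G := G) (x := x) hw ?_ hF ?_ ?_ ?_ ?_ ?_ ?_ ?_ h10) le_rfl ?_
    · exact hadj.congr fun i hi => hm i (by omega)
    · rw [hr 0 (by omega), h0]
    · rw [hr 3 (by omega), h3]
    · rw [hr 4 (by omega), h4]
    · rw [hr 7 (by omega)]; exact h7
    · omega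
    · rw [hr 7 (by omega)]; omega
    · omega
    rintro s'' ⟨hm'', hx'', hF'', hr'', h8'', h9'', hp''⟩
    rw [hr 7 (by omega), h8] at hm'' hx''
    rw [← burned_append_singleton] at hF'' hp''
    have hlen' : (B ++ [x]).length = B.length + 1 := by simp
    refine ⟨⟨fun r h => (hr'' r h).trans (hr r h), fun a ha => ?_, B ++ [x], by omega, ?_, ?_, ?_,
      hBx, ?_, ?_⟩, by omega⟩
    · rw [hm'' a (by omega) (by omega), hm a ha]
    · rw [h9'', h9, hlen', Nat.succ_mul B.length]; omega
    · rintro ⟨i, hi⟩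
      rcases Nat.lt_succ_iff_lt_or_eq.1 (hlen' ▸ hi) with h | rfl
      · have h1 := hS ⟨i, h⟩
        simp only [List.get_eq_getElem] at h1 ⊢
        rw [hm'' _ (by omega) (by omega), h1, List.getElem_append_left h]
      · simpa using hx''
    · rw [h9'']; exact hF''
    · intro m hm
      have := hB.length_le hG hx hm
      omega
    · exact hp''.imp_right fun ⟨y, h1, h2⟩ => ⟨y, h1, h2, by simp⟩
  · refine ⟨r1, fun a _ => by rw [m1], [], a8, by simpa using a9, fun i => i.elim0, ?_,
      IsGreedyFrom.nil c, by simp, Or.inr ⟨c, a10, by simp [burned], by simp⟩⟩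
    rw [a9]
    exact hZ.congr fun i _ => by rw [m1]

/-- The initial value `n + 1` of the least length in register `2` exceeds the length of every greedy
sequence, so that the first sequence found replaces it. -/
theorem burningProg_runs (hw : 4 * (n * n) + 4 * n + 4 < 2 ^ w) (hG : G.Connected) :
    Runs w burningProg (100 * n ^ 4) (graphInput G) fun s => ∃ B : List (Fin n),
      s.output = B.map Fin.val ∧ IsBurningSequence G B ∧
      ∀ c m, (∀ v, G.dist c v ≤ m) → B.length ≤ m + 1 := by
  have hn : 0 < n := hG.nonempty.elim fun v => v.pos
  have hle : n ≤ n * n := Nat.le_mul_self n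
  refine Runs.mono (T := 5 + ((n * (((28 * (n * n * n) + 29 * n + 5) + (4 + 3)) + 1) + 1) + 2))
    (R := _) ?_ ?_ fun _ h => h
  swap
  · have h1 : n ^ 1 ≤ n ^ 4 := Nat.pow_le_pow_right hn (by norm_num)
    have h2 : n ^ 2 ≤ n ^ 4 := Nat.pow_le_pow_right hn (by norm_num)
    have h3 : n * (((28 * (n * n * n) + 29 * n + 5) + (4 + 3)) + 1) =
      28 * n ^ 4 + 29 * n ^ 2 + 13 * n ^ 1 := by ring
    have h4 : 1 ≤ n ^ 4 := Nat.one_le_pow _ _ hn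
    omega
  have hZ : (graphInput G).Marks (2 * (n * n)) (∅ : Set (Fin n)) := by
    intro v
    simp only [Set.mem_empty_iff_false, if_false, graphInput]
    refine if_neg ?_
    rintro ⟨u, u', h, -⟩
    have := u.mul_add_lt u'
    omega
  refine Runs.seq (Q := fun s => s.mem = (graphInput G).mem ∧ s.reg 0 = n ∧ s.reg 2 = n + 1 ∧
    s.reg 3 = 1 ∧ s.reg 4 = 0 ∧ s.reg 5 = 0 ∧ s.reg 6 = 2 * (n * n) ∧ s.reg 7 = n * n) ?_ ?_
  · refine Runs.block (by simp) ⟨?_, ?_, ?_, ?_, ?_, ?_, ?_, ?_⟩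
    all_goals simp (disch := omega) [execList, Instr.exec, State.setReg, graphInput,
      Nat.mod_eq_of_lt, two_mul]
  rintro s1 ⟨m1, a0, a2, a3, a4, a5, a6, a7⟩
  refine Runs.seq (Q := fun s => ∃ B : List (Fin n), s.reg 2 = B.length ∧
    (∀ i : Fin B.length, s.mem (s.reg 1 + i) = B.get i) ∧ IsBurningSequence G B ∧
    ∀ c m, (∀ v, G.dist c v ≤ m) → B.length ≤ m + 1) ?_ ?_
  · have := Runs.loop (w := w) (b := .lt 5 0) (T := (28 * (n * n * n) + 29 * n + 5) + (4 + 3))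
      (s := s1) (p := .seq greedyProg
        (.seq (.branch (.lt 8 2) (block [.move 2 8, .move 1 7]) .skip)
          (block [.add 7 7 0, .add 5 5 3])))
      (fun s => s.reg 0 = n ∧ s.reg 3 = 1 ∧ s.reg 4 = 0 ∧ s.reg 5 ≤ n ∧ s.reg 6 = 2 * (n * n) ∧
        s.reg 7 = n * n + s.reg 5 * n ∧ s.HasAdj G ∧ s.Marks (2 * (n * n)) (∅ : Set (Fin n)) ∧
        (∀ c : Fin n, (c : ℕ) < s.reg 5 → ∀ m, (∀ v, G.dist c v ≤ m) → s.reg 2 ≤ m + 1) ∧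
        ((s.reg 5 = 0 ∧ s.reg 2 = n + 1) ∨ ∃ B : List (Fin n), s.reg 2 = B.length ∧
          s.reg 1 + B.length ≤ s.reg 7 ∧
          (∀ i : Fin B.length, s.mem (s.reg 1 + i) = B.get i) ∧ IsBurningSequence G B))
      (fun s => n - s.reg 5) ?_ ?_
    · refine this.mono (by simp [a5]) ?_
      rintro s ⟨⟨h0, h3, h4, h5, h6, h7, hadj, hZ, hlen, hB⟩, hb⟩
      simp only [Test.Holds, h0, not_lt] at hb
      obtain ⟨B, hB1, hB2, hB3, hB4⟩ := hB.resolve_left (by omega)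
      exact ⟨B, hB1, hB3, hB4, fun c => hB1 ▸ hlen c (c.isLt.trans_le hb)⟩
    · rintro s ⟨h0, h3, h4, h5, h6, h7, hadj, hZ, hlen, hB⟩ hb
      simp only [Test.Holds, h0] at hb
      obtain ⟨c, hc⟩ : ∃ c : Fin n, s.reg 5 = c := ⟨⟨_, hb⟩, rfl⟩
      have hcn := Nat.mul_le_mul_right n c.isLt
      rw [Nat.succ_mul] at hcn
      rw [hc] at h7
      refine Runs.seq (greedyProg_runs (c := c) hw hG hadj hZ h0 h3 h4 hc h6 (by omega)
        (by omega)) ?_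
      rintro s2 ⟨r2, m2, B, hB1, hBn, hB2, hB3, hB4⟩
      have hmem : ∀ a, a < n * n ∨ (2 * (n * n) ≤ a ∧ a < 2 * (n * n) + n) →
          s2.mem a = s.mem a := fun a ha => m2 a (by omega)
      refine Runs.seq (Q := fun s' => s'.mem = s2.mem ∧
        (∀ r < 8, 2 < r ∨ r = 0 → s'.reg r = s.reg r) ∧ s'.reg 2 ≤ s.reg 2 ∧
        s'.reg 2 ≤ B.length ∧ ∃ B : List (Fin n), s'.reg 2 = B.length ∧
          s'.reg 1 + B.length ≤ s.reg 7 + n ∧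
          (∀ i : Fin B.length, s2.mem (s'.reg 1 + i) = B.get i) ∧ IsBurningSequence G B) ?_ ?_
      · refine Runs.branch (T := 3) (fun hb => Runs.block (by simp) ?_)
          (fun hb => ⟨1, s2, .skip _, by omega, rfl, fun r hr _ => r2 r hr, ?_, ?_, ?_⟩)
        all_goals simp only [Test.Holds, hB1, r2 2 (by omega)] at hb
        · refine ⟨?_, ?_, ?_, ?_, B, ?_, ?_, ?_, hB3⟩
          · simp [execList, Instr.exec, State.setReg]
          · intro r hr hr'
            rw [← r2 r hr]
            simp (disch := omega) [execList, Instr.exec, State.setReg, Function.update_of_ne]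
          · simp [execList, Instr.exec, State.setReg, hB1, hb.le]
          · simp [execList, Instr.exec, State.setReg, hB1]
          · simp [execList, Instr.exec, State.setReg, hB1]
          · simp [execList, Instr.exec, State.setReg, r2 7, hBn]
          · simpa [execList, Instr.exec, State.setReg, r2 7] using hB2
        · rw [r2 2 (by omega)]
        · rw [r2 2 (by omega)]; omega
        · obtain ⟨B', hB'1, hB'2, hB'3, hB'4⟩ := hB.resolve_left (by omega)
          refine ⟨B', by rw [r2 2 (by omega), hB'1], by rw [r2 1 (by omega)]; omega, ?_, hB'4⟩
          rintro ⟨i, hi⟩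
          rw [r2 1 (by omega), m2 _ (by simp only; omega)]
          exact hB'3 ⟨i, hi⟩
      rintro s3 ⟨m3, r3, h2, h2', B', hB'1, hB'2, hB'3, hB'4⟩
      have e0 := (r3 0 (by omega) (by omega)).trans h0
      have e3 := (r3 3 (by omega) (by omega)).trans h3
      have e4 := (r3 4 (by omega) (by omega)).trans h4
      have e5 := (r3 5 (by omega) (by omega)).trans hc
      have e6 := (r3 6 (by omega) (by omega)).trans h6
      have e7 := (r3 7 (by omega) (by omega)).trans h7
      generalize hs4 : execList w [.add 7 7 0, .add 5 5 3] s3 = s4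
      have m4 : s4.mem = s2.mem := by
        simp [← hs4, execList, Instr.exec, State.setReg, m3]
      have f5 : s4.reg 5 = c + 1 := by
        simp (disch := omega) [← hs4, execList, Instr.exec, State.setReg, e5, e3, Nat.mod_eq_of_lt]
      have f7 : s4.reg 7 = n * n + (c + 1) * n := by
        rw [Nat.succ_mul]
        simp (disch := omega) [← hs4, execList, Instr.exec, State.setReg, e7, e0, Nat.mod_eq_of_lt,
          add_assoc]
      have f : ∀ r < 5, s4.reg r = s3.reg r := fun r hr => by
        simp (disch := omega) [← hs4, execList, Instr.exec, State.setReg, Function.update_of_ne]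
      refine Runs.block (by simp) ?_
      rw [hs4]
      refine ⟨⟨?_, ?_, ?_, ?_, ?_, ?_, ?_, ?_, ?_, Or.inr ⟨B', ?_, ?_, ?_, hB'4⟩⟩, ?_⟩
      · rw [f 0 (by omega), e0]
      · rw [f 3 (by omega), e3]
      · rw [f 4 (by omega), e4]
      · omega
      · simp [← hs4, execList, Instr.exec, State.setReg, e6]
      · rw [f7, f5]
      · exact hadj.congr fun i hi => by rw [m4, hmem i (by omega)]
      · exact hZ.congr fun i hi => by rw [m4, hmem _ (by omega)]
      · intro c' hc' m hm
        rw [f 2 (by omega)]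
        by_cases h : c' = c
        · exact h2'.trans (hB4 m (h ▸ hm))
        · have h' : (c' : ℕ) ≠ c := fun h' => h (Fin.ext h')
          exact h2.trans (hlen c' (by omega) m hm)
      · rw [f 2 (by omega), hB'1]
      · rw [f 1 (by omega), f7, Nat.succ_mul]; omega
      · rw [f 1 (by omega), m4]; exact hB'3
      · omega
    · refine ⟨a0, a3, a4, by omega, a6, by simp [a7, a5], ?_, ?_, fun c hc => by omega,
        Or.inl ⟨a5, a2⟩⟩
      · exact (hasAdj_graphInput G).congr fun i _ => by rw [m1]
      · exact hZ.congr fun i _ => by rw [m1]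
  rintro s2 ⟨B, hB1, hB2, hB3, hB4⟩
  refine Runs.block (by simp) ⟨B, ?_, hB3, hB4⟩
  have : (execList w [.move 0 2] s2).output =
      (List.range B.length).map fun i => s2.mem (s2.reg 1 + i) := by
    simp [State.output, execList, Instr.exec, State.setReg, hB1]
  rw [this]
  refine List.ext_getElem (by simp) fun i h1 h2 => ?_
  simpa using hB2 ⟨i, by simpa using h2⟩

end

end WordRAM

/-! ### Burning graphs without long induced paths -/

theorem mainTheorem9 :
    ∃ (P : WordRAM.Prog) (c C : ℕ), ∀ (n : ℕ) (G : SimpleGraph (Fin n)) (k : ℕ),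
      G.Connected → 2 ≤ k → Burning.IsPathFree G k →
      ∀ w : ℕ, c * Nat.size n ≤ w →
        ∃ (t : ℕ) (s : WordRAM.State),
          WordRAM.Exec w P (WordRAM.graphInput G) t s ∧
          t ≤ C * (k * n ^ 7) ∧
          ∃ B : List (Fin n),
            s.output = List.map Fin.val B ∧
            Burning.IsBurningSequence G B ∧
            B.length ≤ ⌈((k : ℝ) + 1) / 2⌉₊ := by
  refine ⟨WordRAM.burningProg, 8, 100, fun n G k hG hk hfree w hw => ?_⟩
  have hn : 0 < n := hG.nonempty.elim fun v => v.pos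
  obtain ⟨c, hc⟩ := hG.exists_forall_dist_le (m := k / 2) fun h =>
    hfree ((SimpleGraph.pathGraph_isIndContained_pathGraph (by omega)).trans h)
  -- `n < 2 ^ Nat.size n`, so `8 * Nat.size n` bits suffice for numbers up to `(n + 1) ^ 8`.
  have hw' : 4 * (n * n) + 4 * n + 4 < 2 ^ w := by
    have h1 : (n + 1) ^ 8 ≤ 2 ^ w := by
      refine le_trans (Nat.pow_le_pow_left (Nat.lt_size_self n) 8) ?_
      rw [← pow_mul, mul_comm]
      exact Nat.pow_le_pow_right (by norm_num) hw
    have h2 : (n + 1) ^ 2 * 2 ^ 6 ≤ (n + 1) ^ 2 * (n + 1) ^ 6 :=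
      Nat.mul_le_mul_left _ (Nat.pow_le_pow_left (by omega) 6)
    nlinarith
  obtain ⟨t, s, hexec, ht, B, hout, hB, hlen⟩ := WordRAM.burningProg_runs hw' hG
  refine ⟨t, s, hexec, ht.trans (Nat.mul_le_mul_left _ ?_), B, hout, hB, ?_⟩
  · calc n ^ 4 ≤ n ^ 7 := Nat.pow_le_pow_right hn (by norm_num)
      _ ≤ k * n ^ 7 := Nat.le_mul_of_pos_left _ (by omega)
  · have h1 : k + 1 ≤ 2 * ⌈((k : ℝ) + 1) / 2⌉₊ := by
      have := Nat.le_ceil (((k : ℝ) + 1) / 2)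
      have : ((k + 1 : ℕ) : ℝ) ≤ ((2 * ⌈((k : ℝ) + 1) / 2⌉₊ : ℕ) : ℝ) := by
        push_cast
        linarith
      exact_mod_cast this
    have h2 := hlen c _ hc
    omega
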